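/- Let $G$ be a finite-dimensional real Lie group, let $V$ be a real vector space of finite dimension $n$ with basis $\alpha_1,\dots,\alpha_n$ and linear coordinates $x_1,\dots,x_n$, and let $\Phi:G\to \mathrm{Aut}(V)$ be a (smooth) representation with associated action $\rho:G\times V\to V$, $\rho(a,p)=\Phi(a)(p)$. The tangent bundle $TG$ is a group, whose product is the tangent map of the product of $G$ (with $TG\times TG$ identified with $T(G\times G)$). The tangent bundle $TV$ is a $2n$-dimensional real vector space with $X\oplus Y=(T\tau_y)X+(T\tau_x)Y$ for $X\in T_xV$, $Y\in T_yV$, and $\lambda\bullet X=(T\sigma_\lambda)X$, where $\tau_z$ is the translation of $V$ by $z$ and $\sigma_\lambda$ the multiplication by $\lambda$. The map $\psi:TV\to V\times\mathbb{R}^n$, $\psi(Y_p)=(p,(Y_p[x_1],\dots,Y_p[x_n]))$, is a linear isomorphism; let $\tilde\alpha_i=\psi^{-1}(\alpha_i,0)$ and $\tilde y_i=\psi^{-1}(0,e_i)$. Let $Z:\mathrm{Aut}(V)\to GL(n,\mathbb{R})$ and $\breve Z:\mathrm{Aut}(TV)\to GL(2n,\mathbb{R})$ be the isomorphisms that take an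 automorphism to its matrix with respect to $(\alpha_i)$ and to $(\tilde\alpha_1,\dots,\tilde\alpha_n,\tilde y_1,\dots,\tilde y_n)$, respectively. Let $J_n:T(GL(n,\mathbb{R}))\to GL(2n,\mathbb{R})$ be the homomorphism $$J_n(Y)=\begin{pmatrix} a&0\\ Ba&a\end{pmatrix},\qquad Y\in T_a(GL(n,\mathbb{R})),\quad B=TR_{a^{-1}}(Y),$$ where $R_{c}(y)=yc$ and $T_1(GL(n,\mathbb{R}))$ is identified with the space of $n\times n$ matrices. The prolongation of $\Phi$ is the homomorphism $$\widetilde\Phi=\breve Z^{-1}\circ J_n\circ TZ\circ T\Phi:TG\to\mathrm{Aut}(TV).$$ Then the tangent map $T\rho:TG\times TV\to TV$ (with $TG\times TV$ identified with $T(G\times V)$) is a smooth action of the group $TG$ on $TV$: $T\rho(1,Y)=Y$ and $T\rho(XX',Y)=T\rho(X,T\rho(X',Y))$ for all $X,X'\in TG$ and $Y\in TV$. It is the action that corresponds to $\widetilde\Phi$: $$T\rho(X_a,Y_p)=\widetilde\Phi(X_a)(Y_p)\qquad\text{for all } X_a\in TG,\ Y_p\in TV.$$ -/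

import Mathlib

open scoped Manifold ContDiff

noncomputable section

namespace Prolongation

section TangentFunctor

variable {E H M E₁ H₁ M₁ E₂ H₂ M₂ E₃ H₃ M₃ : Type*}
  [NormedAddCommGroup E] [NormedSpace ℝ E] [TopologicalSpace H] {I : ModelWithCorners ℝ E H}
  [TopologicalSpace M] [ChartedSpace H M]
  [NormedAddCommGroup E₁] [NormedSpace ℝ E₁] [TopologicalSpace H₁]
  {I₁ : ModelWithCorners ℝ E₁ H₁} [TopologicalSpace M₁] [ChartedSpace H₁ M₁]
  [NormedAddCommGroup E₂] [NormedSpace ℝ E₂] [TopologicalSpace H₂]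
  {I₂ : ModelWithCorners ℝ E₂ H₂} [TopologicalSpace M₂] [ChartedSpace H₂ M₂]
  [NormedAddCommGroup E₃] [NormedSpace ℝ E₃] [TopologicalSpace H₃]
  {I₃ : ModelWithCorners ℝ E₃ H₃} [TopologicalSpace M₃] [ChartedSpace H₃ M₃]

variable (I₁ I₂ I₃) in
/-- The tangent map `Tf : TM₁ × TM₂ → TM₃` of a map `f : M₁ × M₂ → M₃`, where `TM₁ × TM₂` is
identified with `T(M₁ × M₂)` in the canonical way. -/
def tangentMapProd (f : M₁ × M₂ → M₃) :
    TangentBundle I₁ M₁ × TangentBundle I₂ M₂ → TangentBundle I₃ M₃ :=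
  fun q => tangentMap (I₁.prod I₂) I₃ f ((equivTangentBundleProd I₁ M₁ I₂ M₂).symm q)

theorem tangentMapProd_tangentMap {f : M₁ × M₂ → M₃} {g₁ : M → M₁} {g₂ : M → M₂}
    (hf : MDifferentiable (I₁.prod I₂) I₃ f) (h₁ : MDifferentiable I I₁ g₁)
    (h₂ : MDifferentiable I I₂ g₂) (X : TangentBundle I M) :
    tangentMapProd I₁ I₂ I₃ f (tangentMap I I₁ g₁ X, tangentMap I I₂ g₂ X) =
      tangentMap I I₃ (fun x => f (g₁ x, g₂ x)) X := by
  have h : (equivTangentBundleProd I₁ M₁ I₂ M₂).symm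
      (tangentMap I I₁ g₁ X, tangentMap I I₂ g₂ X) =
      tangentMap I (I₁.prod I₂) (fun x => (g₁ x, g₂ x)) X := by
    simp only [tangentMap, mfderiv_prodMk (h₁ X.1) (h₂ X.1)]
    rfl
  unfold tangentMapProd
  rw [h]
  exact (congrFun (tangentMap_comp hf (h₁.prodMk h₂)) X).symm

theorem tangentMap_fst_pair (X : TangentBundle I₁ M₁) (Y : TangentBundle I₂ M₂) :
    tangentMap (I₁.prod I₂) I₁ Prod.fst ((equivTangentBundleProd I₁ M₁ I₂ M₂).symm (X, Y)) = X := by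
  rw [tangentMap_prodFst]; rfl

theorem tangentMap_snd_pair (X : TangentBundle I₁ M₁) (Y : TangentBundle I₂ M₂) :
    tangentMap (I₁.prod I₂) I₂ Prod.snd ((equivTangentBundleProd I₁ M₁ I₂ M₂).symm (X, Y)) = Y := by
  rw [tangentMap_prodSnd]; rfl

end TangentFunctor

section TangentGroup

variable {E H G E' H' G' : Type*}
  [NormedAddCommGroup E] [NormedSpace ℝ E] [TopologicalSpace H] {I : ModelWithCorners ℝ E H}
  [TopologicalSpace G] [ChartedSpace H G] [Group G]
  [NormedAddCommGroup E'] [NormedSpace ℝ E'] [TopologicalSpace H'] {I' : ModelWithCorners ℝ E' H'}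
  [TopologicalSpace G'] [ChartedSpace H' G'] [Group G']

/-- The product of `TG` is the tangent map of the product of `G`. -/
instance tangentMul : Mul (TangentBundle I G) where
  mul X Y := tangentMapProd I I I (fun q : G × G => q.1 * q.2) (X, Y)

/-- The unit element of `TG` is the zero vector at the unit element of `G`. -/
instance tangentOne : One (TangentBundle I G) where
  one := ⟨1, 0⟩

/-- The inverse of `TG` is the tangent map of the inverse of `G`. -/
instance tangentInv : Inv (TangentBundle I G) where
  inv X := tangentMap I I (fun a : G => a⁻¹) X

theorem tangent_mul_def (X Y : TangentBundle I G) :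
    X * Y = tangentMapProd I I I (fun q : G × G => q.1 * q.2) (X, Y) := rfl

theorem mdifferentiable_mul [LieGroup I ∞ G] :
    MDifferentiable (I.prod I) I (fun q : G × G => q.1 * q.2) :=
  (contMDiff_mul I ∞).mdifferentiable (by simp)

theorem mdifferentiable_inv [LieGroup I ∞ G] :
    MDifferentiable I I (fun a : G => a⁻¹) :=
  (contMDiff_inv I ∞).mdifferentiable (by simp)

theorem tangentMap_const_one (X : TangentBundle I G) :
    tangentMap I I (fun _ : G => (1 : G)) X = 1 := by
  simp only [tangentMap, mfderiv_const]
  rfl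

/-- The tangent group `TG` of a Lie group `G`. -/
instance tangentGroup [LieGroup I ∞ G] : Group (TangentBundle I G) :=
  Group.ofLeftAxioms
    (by
      intro X Y Z
      have hX := tangentMap_fst_pair X ((equivTangentBundleProd I G I G).symm (Y, Z))
      have hYZ := tangentMap_snd_pair X ((equivTangentBundleProd I G I G).symm (Y, Z))
      generalize (equivTangentBundleProd I G (I.prod I) (G × G)).symm
        (X, (equivTangentBundleProd I G I G).symm (Y, Z)) = W at hX hYZ
      have hY := tangentMap_fst_pair Y Z
      have hZ := tangentMap_snd_pair Y Z
      have d₁ : MDifferentiable (I.prod (I.prod I)) I (fun w : G × G × G => w.1) :=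
        mdifferentiable_fst
      have ds : MDifferentiable (I.prod (I.prod I)) (I.prod I) (fun w : G × G × G => w.2) :=
        mdifferentiable_snd
      have d₂ : MDifferentiable (I.prod (I.prod I)) I (fun w : G × G × G => w.2.1) :=
        mdifferentiable_fst.comp ds
      have d₃ : MDifferentiable (I.prod (I.prod I)) I (fun w : G × G × G => w.2.2) :=
        mdifferentiable_snd.comp ds
      have hX' : tangentMap (I.prod (I.prod I)) I (fun w : G × G × G => w.1) W = X := hX
      have hY' : tangentMap (I.prod (I.prod I)) I (fun w : G × G × G => w.2.1) W = Y := by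
        rw [← hYZ] at hY
        rw [← hY]
        exact congrFun (tangentMap_comp mdifferentiable_fst ds) W
      have hZ' : tangentMap (I.prod (I.prod I)) I (fun w : G × G × G => w.2.2) W = Z := by
        rw [← hYZ] at hZ
        rw [← hZ]
        exact congrFun (tangentMap_comp mdifferentiable_snd ds) W
      have dm := mdifferentiable_mul (I := I) (G := G)
      simp only [tangent_mul_def]
      have d₁₂ : MDifferentiable (I.prod (I.prod I)) I (fun w : G × G × G => w.1 * w.2.1) :=
        dm.comp (d₁.prodMk d₂)
      have d₂₃ : MDifferentiable (I.prod (I.prod I)) I (fun w : G × G × G => w.2.1 * w.2.2) :=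
        dm.comp (d₂.prodMk d₃)
      rw [← hX', ← hY', ← hZ', tangentMapProd_tangentMap dm d₁ d₂,
        tangentMapProd_tangentMap dm d₂ d₃, tangentMapProd_tangentMap dm d₁₂ d₃,
        tangentMapProd_tangentMap dm d₁ d₂₃]
      simp only [mul_assoc])
    (by
      intro X
      rw [tangent_mul_def, ← tangentMap_const_one (I := I) X]
      have := tangentMapProd_tangentMap (mdifferentiable_mul (I := I) (G := G))
        (mdifferentiable_const (I := I) (I' := I) (c := (1 : G))) mdifferentiable_id X
      simp only [id, one_mul] at this
      have hid : tangentMap I I (id : G → G) X = X := congrFun tangentMap_id X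
      rw [hid] at this
      exact this.trans hid)
    (by
      intro X
      have := tangentMapProd_tangentMap (mdifferentiable_mul (I := I) (G := G))
        (mdifferentiable_inv (I := I) (G := G)) mdifferentiable_id X
      rw [tangentMap_id] at this
      simp only [id, inv_mul_cancel] at this
      rw [tangentMap_const_one] at this
      exact this)

/-- The tangent map `Tγ : TG → TG'` of a Lie group homomorphism `γ : G → G'`, as a group
homomorphism. -/
def tangentHom [LieGroup I ∞ G] [LieGroup I' ∞ G'] (γ : ContMDiffMonoidMorphism I I' ∞ G G') :
    TangentBundle I G →* TangentBundle I' G' :=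
  MonoidHom.mk' (tangentMap I I' γ.toMonoidHom) (by
    intro X Y
    have dγ : MDifferentiable I I' γ.toMonoidHom := γ.contMDiff_toFun.mdifferentiable (by simp)
    have hX := tangentMap_fst_pair X Y
    have hY := tangentMap_snd_pair X Y
    have h : X * Y = tangentMap (I.prod I) I (fun q : G × G => q.1 * q.2)
      ((equivTangentBundleProd I G I G).symm (X, Y)) := rfl
    rw [h]
    generalize (equivTangentBundleProd I G I G).symm (X, Y) = W at hX hY
    subst hX hY
    have h₁ := congrFun (tangentMap_comp dγ (mdifferentiable_mul (I := I) (G := G))) W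
    have h₂ := congrFun (tangentMap_comp dγ
      (mdifferentiable_fst (I := I) (I' := I) (M := G) (M' := G))) W
    have h₃ := congrFun (tangentMap_comp dγ
      (mdifferentiable_snd (I := I) (I' := I) (M := G) (M' := G))) W
    simp only [Function.comp_apply] at h₁ h₂ h₃
    rw [← h₁, ← h₂, ← h₃, tangent_mul_def, tangentMapProd_tangentMap mdifferentiable_mul
      (dγ.comp mdifferentiable_fst) (dγ.comp mdifferentiable_snd)]
    simp [Function.comp_def])

end TangentGroup

section TangentVectorSpace

variable {V : Type*} [NormedAddCommGroup V] [NormedSpace ℝ V]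

/-- The sum `X ⊕ Y = (Tτ_y) X + (Tτ_x) Y` of vectors `X` at `x` and `Y` at `y`, where `τ_z` is the
translation of `V` by `z`. -/
instance tangentAdd : Add (TangentBundle 𝓘(ℝ, V) V) where
  add X Y := ⟨X.1 + Y.1,
    mfderiv 𝓘(ℝ, V) 𝓘(ℝ, V) (fun z : V => z + Y.1) X.1 X.2 +
      mfderiv 𝓘(ℝ, V) 𝓘(ℝ, V) (fun z : V => X.1 + z) Y.1 Y.2⟩

/-- The zero of the vector space `TV` is the zero vector at the origin. -/
instance tangentZero : Zero (TangentBundle 𝓘(ℝ, V) V) where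
  zero := ⟨0, 0⟩

/-- The scalar multiplication `c • X = (Tσ_c) X`, where `σ_c` is the multiplication by `c` on `V`. -/
instance tangentSMul : SMul ℝ (TangentBundle 𝓘(ℝ, V) V) where
  smul c X := tangentMap 𝓘(ℝ, V) 𝓘(ℝ, V) (fun z : V => c • z) X

instance tangentNeg : Neg (TangentBundle 𝓘(ℝ, V) V) where
  neg X := (-1 : ℝ) • X

/-- Base point and velocity of a tangent vector of `V`. -/
def velocityEquiv : TangentBundle 𝓘(ℝ, V) V ≃ V × V where
  toFun X := (X.1, X.2)
  invFun q := ⟨q.1, q.2⟩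
  left_inv _ := rfl
  right_inv _ := rfl

theorem velocityEquiv_add (X Y : TangentBundle 𝓘(ℝ, V) V) :
    velocityEquiv (X + Y) = velocityEquiv X + velocityEquiv Y := by
  refine Prod.ext rfl ?_
  change (mfderiv 𝓘(ℝ, V) 𝓘(ℝ, V) (fun z : V => z + Y.1) X.1 X.2 : V) +
      mfderiv 𝓘(ℝ, V) 𝓘(ℝ, V) (fun z : V => X.1 + z) Y.1 Y.2 = _
  rw [mfderiv_eq_fderiv, mfderiv_eq_fderiv, fderiv_add_const, fderiv_const_add]
  simp
  rfl

theorem velocityEquiv_smul (c : ℝ) (X : TangentBundle 𝓘(ℝ, V) V) :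
    velocityEquiv (c • X) = c • velocityEquiv X := by
  refine Prod.ext rfl ?_
  change (mfderiv 𝓘(ℝ, V) 𝓘(ℝ, V) (fun z : V => c • z) X.1 X.2 : V) = _
  rw [mfderiv_eq_fderiv]
  have : fderiv ℝ (fun z : V => c • z) X.1 = c • ContinuousLinearMap.id ℝ V :=
    (c • ContinuousLinearMap.id ℝ V).fderiv
  rw [this]
  rfl

theorem velocityEquiv_zero : velocityEquiv (0 : TangentBundle 𝓘(ℝ, V) V) = 0 := rfl

theorem velocityEquiv_neg (X : TangentBundle 𝓘(ℝ, V) V) :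
    velocityEquiv (-X) = -velocityEquiv X := by
  rw [← neg_one_smul ℝ (velocityEquiv X)]
  exact velocityEquiv_smul (-1) X

instance tangentAddCommGroup : AddCommGroup (TangentBundle 𝓘(ℝ, V) V) :=
  { AddGroup.ofLeftAxioms (G := TangentBundle 𝓘(ℝ, V) V)
      (fun X Y Z => velocityEquiv.injective (by simp only [velocityEquiv_add, add_assoc]))
      (fun X => velocityEquiv.injective (by
        simp only [velocityEquiv_add, velocityEquiv_zero, zero_add]))
      (fun X => velocityEquiv.injective (by
        simp only [velocityEquiv_add, velocityEquiv_neg, velocityEquiv_zero, neg_add_cancel])) with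
    add_comm := fun X Y => velocityEquiv.injective (by
      simp only [velocityEquiv_add, add_comm]) }

/-- The tangent bundle `TV` as a vector space. -/
instance tangentModule : Module ℝ (TangentBundle 𝓘(ℝ, V) V) where
  one_smul X := velocityEquiv.injective (by simp only [velocityEquiv_smul, one_smul])
  mul_smul a b X := velocityEquiv.injective (by simp only [velocityEquiv_smul, mul_smul])
  smul_zero a := velocityEquiv.injective (by
    simp only [velocityEquiv_smul, velocityEquiv_zero, smul_zero])
  smul_add a X Y := velocityEquiv.injective (by
    simp only [velocityEquiv_smul, velocityEquiv_add, smul_add])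
  add_smul a b X := velocityEquiv.injective (by
    simp only [velocityEquiv_smul, velocityEquiv_add, add_smul])
  zero_smul X := velocityEquiv.injective (by
    simp only [velocityEquiv_smul, velocityEquiv_zero, zero_smul])

variable [FiniteDimensional ℝ V] {n : ℕ}

/-- The bundle trivialization `ψ : TV → V × ℝⁿ`, `ψ(Y_p) = (p, (Y_p[x_1], …, Y_p[x_n]))`, where the
`x_i` are the linear coordinates of `V` with respect to the basis `α`. -/
def trivialization (α : Module.Basis (Fin n) ℝ V) :
    TangentBundle 𝓘(ℝ, V) V ≃ₗ[ℝ] V × (Fin n → ℝ) :=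
  have key (X : TangentBundle 𝓘(ℝ, V) V) :
      (fun i => mfderiv 𝓘(ℝ, V) 𝓘(ℝ, ℝ) (fun p : V => α.coord i p) X.1 X.2 : Fin n → ℝ) =
        α.equivFun (velocityEquiv X).2 := by
    funext i
    have : mfderiv 𝓘(ℝ, V) 𝓘(ℝ, ℝ) (fun p : V => α.coord i p) X.1 =
        LinearMap.toContinuousLinearMap (α.coord i) := by
      rw [mfderiv_eq_fderiv]
      exact (LinearMap.toContinuousLinearMap (α.coord i)).fderiv
    rw [this]
    rfl
  { toFun := fun X => (X.1, fun i => mfderiv 𝓘(ℝ, V) 𝓘(ℝ, ℝ) (fun p : V => α.coord i p) X.1 X.2)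
    invFun := fun q => ⟨q.1, α.equivFun.symm q.2⟩
    map_add' := fun X Y => Prod.ext rfl (by
      refine (key (X + Y)).trans ?_
      rw [velocityEquiv_add, Prod.snd_add, map_add, ← key, ← key]
      rfl)
    map_smul' := fun c X => Prod.ext rfl (by
      refine (key (c • X)).trans ?_
      rw [velocityEquiv_smul, Prod.smul_snd, map_smul, ← key]
      rfl)
    left_inv := fun X => velocityEquiv.injective (Prod.ext rfl (by
      refine (congrArg α.equivFun.symm (key X)).trans ?_
      exact α.equivFun.symm_apply_apply _))
    right_inv := fun q => Prod.ext rfl (by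
      refine (key _).trans ?_
      exact α.equivFun.apply_symm_apply _) }

/-- The basis `{α̃_i, ỹ_i}` of `TV`, with `ψ(α̃_i) = (α_i, 0)` and `ψ(ỹ_i) = (0, e_i)`. -/
def tangentBasis (α : Module.Basis (Fin n) ℝ V) :
    Module.Basis (Fin n ⊕ Fin n) ℝ (TangentBundle 𝓘(ℝ, V) V) :=
  (α.prod (Pi.basisFun ℝ (Fin n))).map (trivialization α).symm

end TangentVectorSpace

section Units

variable {R : Type*} [NormedRing R] [NormedAlgebra ℝ R] [CompleteSpace R]

/-- The image of a tangent vector of the open set `Rˣ` of units under the differential of the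
inclusion of `Rˣ` into `R`; for `GL(n, ℝ)` this is the matrix of entries `Y[y^i_j]`. -/
def unitsVelocity (Y : TangentBundle 𝓘(ℝ, R) Rˣ) : R :=
  mfderiv 𝓘(ℝ, R) 𝓘(ℝ, R) (fun a : Rˣ => (a : R)) Y.1 Y.2

/-- `TR_{a⁻¹}(Y)`, a tangent vector at the unit element, for a tangent vector `Y` at `a`. -/
def rightTranslate (Y : TangentBundle 𝓘(ℝ, R) Rˣ) : TangentBundle 𝓘(ℝ, R) Rˣ :=
  tangentMap 𝓘(ℝ, R) 𝓘(ℝ, R) (fun y : Rˣ => y * Y.1⁻¹) Y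

theorem mdifferentiable_unitsVal : MDifferentiable 𝓘(ℝ, R) 𝓘(ℝ, R) (fun a : Rˣ => (a : R)) :=
  (Units.contMDiff_val (n := ∞)).mdifferentiable (by simp)

theorem unitsVelocity_tangentMap {E H M : Type*} [NormedAddCommGroup E] [NormedSpace ℝ E]
    [TopologicalSpace H] {I : ModelWithCorners ℝ E H} [TopologicalSpace M] [ChartedSpace H M]
    {f : M → Rˣ} (hf : MDifferentiable I 𝓘(ℝ, R) f) (X : TangentBundle I M) :
    unitsVelocity (tangentMap I 𝓘(ℝ, R) f X) =
      mfderiv I 𝓘(ℝ, R) (fun x => (f x : R)) X.1 X.2 := by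
  have := mfderiv_comp X.1 (mdifferentiable_unitsVal (f X.1)) (hf X.1)
  exact (DFunLike.congr_fun this X.2).symm

theorem unitsVelocity_mul (X Y : TangentBundle 𝓘(ℝ, R) Rˣ) :
    unitsVelocity (X * Y) = unitsVelocity X * Y.1.val + X.1.val * unitsVelocity Y := by
  have hX := tangentMap_fst_pair X Y
  have hY := tangentMap_snd_pair X Y
  have h : X * Y = tangentMap (𝓘(ℝ, R).prod 𝓘(ℝ, R)) 𝓘(ℝ, R) (fun q : Rˣ × Rˣ => q.1 * q.2)
    ((equivTangentBundleProd 𝓘(ℝ, R) Rˣ 𝓘(ℝ, R) Rˣ).symm (X, Y)) := rfl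
  rw [h]
  generalize (equivTangentBundleProd 𝓘(ℝ, R) Rˣ 𝓘(ℝ, R) Rˣ).symm (X, Y) = W at hX hY
  subst hX hY
  rw [unitsVelocity_tangentMap mdifferentiable_mul, unitsVelocity_tangentMap mdifferentiable_fst,
    unitsVelocity_tangentMap mdifferentiable_snd]
  have d₁ : MDifferentiable (𝓘(ℝ, R).prod 𝓘(ℝ, R)) 𝓘(ℝ, R) (fun q : Rˣ × Rˣ => (q.1 : R)) :=
    mdifferentiable_unitsVal.comp mdifferentiable_fst
  have d₂ : MDifferentiable (𝓘(ℝ, R).prod 𝓘(ℝ, R)) 𝓘(ℝ, R) (fun q : Rˣ × Rˣ => (q.2 : R)) :=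
    mdifferentiable_unitsVal.comp mdifferentiable_snd
  have := ((d₁ W.1).hasMFDerivAt.mul' (d₂ W.1).hasMFDerivAt).mfderiv
  have := DFunLike.congr_fun this W.2
  refine this.trans ?_
  exact add_comm _ _

theorem unitsVelocity_rightTranslate (Y : TangentBundle 𝓘(ℝ, R) Rˣ) :
    unitsVelocity (rightTranslate Y) = unitsVelocity Y * Y.1⁻¹.val := by
  have d : MDifferentiable 𝓘(ℝ, R) 𝓘(ℝ, R) (fun y : Rˣ => y * Y.1⁻¹) :=
    mdifferentiable_mul.comp (mdifferentiable_id.prodMk mdifferentiable_const)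
  refine (unitsVelocity_tangentMap d Y).trans ?_
  have := ((mdifferentiable_unitsVal Y.1).hasMFDerivAt.mul'
    (hasMFDerivAt_const (I := 𝓘(ℝ, R)) (I' := 𝓘(ℝ, R)) (Y.1⁻¹.val : R) Y.1)).mfderiv
  have := DFunLike.congr_fun this Y.2
  refine this.trans ?_
  change (Y.1.val : R) * (0 : R) + unitsVelocity Y * Y.1⁻¹.val = _
  rw [mul_zero, zero_add]

end Units

section GeneralLinear

attribute [local instance] Matrix.linftyOpNormedRing Matrix.linftyOpNormedAlgebra
attribute [-instance] instTopologicalSpaceMatrix Matrix.instUniformSpace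

variable {n : ℕ}

/-- The homomorphism `J_n : T(GL(n, ℝ)) → GL(2n, ℝ)` that takes `[a, B]`, the tangent vector `Y` at
`a` with `B = TR_{a⁻¹}(Y)`, to the block matrix with rows `(a, 0)` and `(B a, a)`. -/
def blockHom : TangentBundle 𝓘(ℝ, Matrix (Fin n) (Fin n) ℝ) (Matrix (Fin n) (Fin n) ℝ)ˣ →*
    (Matrix (Fin n ⊕ Fin n) (Fin n ⊕ Fin n) ℝ)ˣ :=
  MonoidHom.toHomUnits
    { toFun := fun Y =>
        Matrix.fromBlocks Y.1.val 0 (unitsVelocity (rightTranslate Y) * Y.1.val) Y.1.val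
      map_one' := by
        have h : unitsVelocity
            (1 : TangentBundle 𝓘(ℝ, Matrix (Fin n) (Fin n) ℝ) (Matrix (Fin n) (Fin n) ℝ)ˣ) = 0 :=
          map_zero (mfderiv 𝓘(ℝ, Matrix (Fin n) (Fin n) ℝ) 𝓘(ℝ, Matrix (Fin n) (Fin n) ℝ)
            (fun a : (Matrix (Fin n) (Fin n) ℝ)ˣ => (a : Matrix (Fin n) (Fin n) ℝ)) 1)
        rw [unitsVelocity_rightTranslate, h, zero_mul, zero_mul]
        exact Matrix.fromBlocks_one
      map_mul' := by
        intro X Y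
        simp only [unitsVelocity_rightTranslate, Units.inv_mul_cancel_right, unitsVelocity_mul,
          Matrix.fromBlocks_multiply]
        have h : (X * Y).1 = X.1 * Y.1 := rfl
        simp [h] }

variable {V : Type*} [NormedAddCommGroup V] [NormedSpace ℝ V] [FiniteDimensional ℝ V]

/-- The isomorphism that takes an endomorphism `F` of `V` to its matrix `(F^i_j)` with respect to
the basis `α`, `F(α_j) = ∑ i, F^i_j α_i`. -/
def endToMatrix (α : Module.Basis (Fin n) ℝ V) : (V →L[ℝ] V) ≃* Matrix (Fin n) (Fin n) ℝ where
  toFun F := LinearMap.toMatrix α α (F : V →ₗ[ℝ] V)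
  invFun A := LinearMap.toContinuousLinearMap (Matrix.toLin α α A)
  left_inv F := by ext; simp
  right_inv A := by simp
  map_mul' F F' := LinearMap.toMatrix_comp α α α _ _

/-- The Lie group isomorphism `Z : Aut(V) → GL(n, ℝ)`, `Z(F) = (F^i_j)`. -/
def autToGL (α : Module.Basis (Fin n) ℝ V) :
    ContMDiffMonoidMorphism 𝓘(ℝ, V →L[ℝ] V) 𝓘(ℝ, Matrix (Fin n) (Fin n) ℝ) ∞
      (V →L[ℝ] V)ˣ (Matrix (Fin n) (Fin n) ℝ)ˣ where
  toMonoidHom := (Units.mapEquiv (endToMatrix α)).toMonoidHom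
  contMDiff_toFun := by
    apply ContMDiff.of_comp_isOpenEmbedding Units.isOpenEmbedding_val
    let L : (V →L[ℝ] V) →ₗ[ℝ] Matrix (Fin n) (Fin n) ℝ :=
      (LinearMap.toMatrix α α).toLinearMap ∘ₗ LinearMap.toContinuousLinearMap.symm.toLinearMap
    have hL : ContMDiff 𝓘(ℝ, V →L[ℝ] V) 𝓘(ℝ, Matrix (Fin n) (Fin n) ℝ) ∞ L :=
      (LinearMap.toContinuousLinearMap L).contDiff.contMDiff
    exact hL.comp Units.contMDiff_val

/-- The group isomorphism `Z̆ : Aut(TV) → GL(2n, ℝ)` that takes an automorphism of the vector space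
`TV` to its matrix with respect to the basis `{α̃_i, ỹ_i}`. -/
def autTangentToGL (α : Module.Basis (Fin n) ℝ V) :
    (TangentBundle 𝓘(ℝ, V) V ≃ₗ[ℝ] TangentBundle 𝓘(ℝ, V) V) ≃*
      (Matrix (Fin n ⊕ Fin n) (Fin n ⊕ Fin n) ℝ)ˣ :=
  (LinearMap.GeneralLinearGroup.generalLinearEquiv ℝ (TangentBundle 𝓘(ℝ, V) V)).symm.trans
    (Units.mapEquiv (LinearMap.toMatrixAlgEquiv (tangentBasis α)).toMulEquiv)

variable {E H G : Type*} [NormedAddCommGroup E] [NormedSpace ℝ E] [TopologicalSpace H]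
  {I : ModelWithCorners ℝ E H} [TopologicalSpace G] [ChartedSpace H G] [Group G] [LieGroup I ∞ G]

/-- The prolongation `Φ̃ = Z̆⁻¹ ∘ J_n ∘ TZ ∘ TΦ : TG → Aut(TV)` of a representation
`Φ : G → Aut(V)`. -/
def prolongation (α : Module.Basis (Fin n) ℝ V)
    (Φ : ContMDiffMonoidMorphism I 𝓘(ℝ, V →L[ℝ] V) ∞ G (V →L[ℝ] V)ˣ) :
    TangentBundle I G →* (TangentBundle 𝓘(ℝ, V) V ≃ₗ[ℝ] TangentBundle 𝓘(ℝ, V) V) :=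
  (autTangentToGL α).symm.toMonoidHom.comp
    (blockHom.comp ((tangentHom (autToGL α)).comp (tangentHom Φ)))

end GeneralLinear

end Prolongation

end

/-!
The tangent functor preserves products, so it turns the identities of an action `ρ` into those of
`Tρ`, and it writes the action of `Φ` as `TΦ` followed by the tangent map of the evaluation
`(F, p) ↦ F p` of `Aut(V)` on `V`. By the product rule, a tangent vector of `Aut(V)` at `F` with
velocity `A` takes the vector `v` at `p` to the vector `F v + A p` at `F p`. In the basis
`(α̃_i, ỹ_i)` this linear map has the block matrix with rows `(F, 0)` and `(A, F)`, which is `J_n`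
of the tangent vector because the entry `B a` of `J_n` is `A F⁻¹ F = A`.
-/

namespace Prolongation

section TangentFunctor

variable {E₁ H₁ M₁ E₂ H₂ M₂ E₃ H₃ M₃ E₄ H₄ M₄ : Type*}
  [NormedAddCommGroup E₁] [NormedSpace ℝ E₁] [TopologicalSpace H₁]
  {I₁ : ModelWithCorners ℝ E₁ H₁} [TopologicalSpace M₁] [ChartedSpace H₁ M₁]
  [NormedAddCommGroup E₂] [NormedSpace ℝ E₂] [TopologicalSpace H₂]
  {I₂ : ModelWithCorners ℝ E₂ H₂} [TopologicalSpace M₂] [ChartedSpace H₂ M₂]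
  [NormedAddCommGroup E₃] [NormedSpace ℝ E₃] [TopologicalSpace H₃]
  {I₃ : ModelWithCorners ℝ E₃ H₃} [TopologicalSpace M₃] [ChartedSpace H₃ M₃]
  [NormedAddCommGroup E₄] [NormedSpace ℝ E₄] [TopologicalSpace H₄]
  {I₄ : ModelWithCorners ℝ E₄ H₄} [TopologicalSpace M₄] [ChartedSpace H₄ M₄]

theorem contMDiff_tangentMapProd [IsManifold I₁ 1 M₁] [IsManifold I₂ 1 M₂] [IsManifold I₃ 1 M₃]
    {m n : WithTop ℕ∞} {f : M₁ × M₂ → M₃} (hf : ContMDiff (I₁.prod I₂) I₃ n f)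
    (hmn : m + 1 ≤ n) :
    ContMDiff (I₁.tangent.prod I₂.tangent) I₃.tangent m (tangentMapProd I₁ I₂ I₃ f) :=
  (hf.contMDiff_tangentMap hmn).comp contMDiff_equivTangentBundleProd_symm

theorem exists_tangentMap_fst_snd (X : TangentBundle I₁ M₁) (Y : TangentBundle I₂ M₂) :
    ∃ W : TangentBundle (I₁.prod I₂) (M₁ × M₂),
      tangentMap (I₁.prod I₂) I₁ Prod.fst W = X ∧ tangentMap (I₁.prod I₂) I₂ Prod.snd W = Y :=
  ⟨_, tangentMap_fst_pair X Y, tangentMap_snd_pair X Y⟩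

theorem exists_tangentMap_proj₃ (X : TangentBundle I₁ M₁) (Y : TangentBundle I₂ M₂)
    (Z : TangentBundle I₃ M₃) :
    ∃ W : TangentBundle (I₁.prod (I₂.prod I₃)) (M₁ × M₂ × M₃),
      tangentMap (I₁.prod (I₂.prod I₃)) I₁ (fun w : M₁ × M₂ × M₃ => w.1) W = X ∧
      tangentMap (I₁.prod (I₂.prod I₃)) I₂ (fun w : M₁ × M₂ × M₃ => w.2.1) W = Y ∧
      tangentMap (I₁.prod (I₂.prod I₃)) I₃ (fun w : M₁ × M₂ × M₃ => w.2.2) W = Z := by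
  obtain ⟨W', rfl, rfl⟩ := exists_tangentMap_fst_snd Y Z
  obtain ⟨W, rfl, rfl⟩ := exists_tangentMap_fst_snd X W'
  exact ⟨W, rfl, congrFun (tangentMap_comp mdifferentiable_fst mdifferentiable_snd) W,
    congrFun (tangentMap_comp mdifferentiable_snd mdifferentiable_snd) W⟩

theorem tangentMapProd_tangentMap_left {f : M₂ × M₃ → M₄} {g : M₁ → M₂}
    (hf : MDifferentiable (I₂.prod I₃) I₄ f) (hg : MDifferentiable I₁ I₂ g)
    (X : TangentBundle I₁ M₁) (Y : TangentBundle I₃ M₃) :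
    tangentMapProd I₂ I₃ I₄ f (tangentMap I₁ I₂ g X, Y) =
      tangentMapProd I₁ I₃ I₄ (fun q => f (g q.1, q.2)) (X, Y) := by
  obtain ⟨W, rfl, rfl⟩ := exists_tangentMap_fst_snd X Y
  have hfg : MDifferentiable (I₁.prod I₃) I₄ fun q : M₁ × M₃ => f (g q.1, q.2) :=
    hf.comp ((hg.comp mdifferentiable_fst).prodMk mdifferentiable_snd)
  rw [← Function.comp_apply (f := tangentMap I₁ I₂ g),
    ← tangentMap_comp hg mdifferentiable_fst,
    tangentMapProd_tangentMap hf (hg.comp mdifferentiable_fst) mdifferentiable_snd,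
    tangentMapProd_tangentMap hfg mdifferentiable_fst mdifferentiable_snd]
  rfl

end TangentFunctor

section TangentAction

variable {E H G E' H' M : Type*} [NormedAddCommGroup E] [NormedSpace ℝ E] [TopologicalSpace H]
  {I : ModelWithCorners ℝ E H} [TopologicalSpace G] [ChartedSpace H G] [Group G]
  [NormedAddCommGroup E'] [NormedSpace ℝ E'] [TopologicalSpace H']
  {I' : ModelWithCorners ℝ E' H'} [TopologicalSpace M] [ChartedSpace H' M] {ρ : G × M → M}

theorem tangentMapProd_one_left (hρ : MDifferentiable (I.prod I') I' ρ)
    (one_act : ∀ p, ρ (1, p) = p) (Y : TangentBundle I' M) :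
    tangentMapProd I I' I' ρ (1, Y) = Y := by
  have tangentMap_one : tangentMap I' I (fun _ : M => (1 : G)) Y = 1 := by
    simp only [tangentMap, mfderiv_const]
    rfl
  calc tangentMapProd I I' I' ρ (1, Y)
      = tangentMapProd I I' I' ρ
          (tangentMap I' I (fun _ : M => (1 : G)) Y, tangentMap I' I' id Y) := by
        rw [tangentMap_one, tangentMap_id, id]
    _ = tangentMap I' I' (fun p => ρ (1, p)) Y :=
        tangentMapProd_tangentMap hρ mdifferentiable_const mdifferentiable_id Y
    _ = tangentMap I' I' id Y := by simp only [one_act]; rfl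
    _ = Y := by rw [tangentMap_id, id]

theorem tangentMapProd_mul_left [LieGroup I ∞ G] (hρ : MDifferentiable (I.prod I') I' ρ)
    (mul_act : ∀ a b p, ρ (a * b, p) = ρ (a, ρ (b, p)))
    (X X' : TangentBundle I G) (Y : TangentBundle I' M) :
    tangentMapProd I I' I' ρ (X * X', Y) =
      tangentMapProd I I' I' ρ (X, tangentMapProd I I' I' ρ (X', Y)) := by
  obtain ⟨W, rfl, rfl, rfl⟩ := exists_tangentMap_proj₃ X X' Y
  have h₁ : MDifferentiable (I.prod (I.prod I')) I (fun w : G × G × M => w.1) :=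
    mdifferentiable_fst
  have h₂ : MDifferentiable (I.prod (I.prod I')) I (fun w : G × G × M => w.2.1) :=
    mdifferentiable_fst.comp mdifferentiable_snd
  have h₃ : MDifferentiable (I.prod (I.prod I')) I' (fun w : G × G × M => w.2.2) :=
    mdifferentiable_snd.comp mdifferentiable_snd
  have h₁₂ : MDifferentiable (I.prod (I.prod I')) I (fun w : G × G × M => w.1 * w.2.1) :=
    mdifferentiable_mul.comp (h₁.prodMk h₂)
  have h₂₃ : MDifferentiable (I.prod (I.prod I')) I' (fun w : G × G × M => ρ (w.2.1, w.2.2)) :=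
    hρ.comp (h₂.prodMk h₃)
  rw [tangent_mul_def, tangentMapProd_tangentMap mdifferentiable_mul h₁ h₂,
    tangentMapProd_tangentMap hρ h₁₂ h₃, tangentMapProd_tangentMap hρ h₂ h₃,
    tangentMapProd_tangentMap hρ h₁ h₂₃]
  simp only [mul_act]

end TangentAction

section VectorSpace

variable {U V W : Type*} [NormedAddCommGroup U] [NormedSpace ℝ U]
  [NormedAddCommGroup V] [NormedSpace ℝ V] [NormedAddCommGroup W] [NormedSpace ℝ W]

theorem hasMFDerivAt_of_isBoundedBilinearMap {b : U × V → W} (hb : IsBoundedBilinearMap ℝ b)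
    (q : U × V) : HasMFDerivAt (𝓘(ℝ, U).prod 𝓘(ℝ, V)) 𝓘(ℝ, W) b q (hb.deriv q) := by
  rw [← modelWithCornersSelf_prod, chartedSpaceSelf_prod]
  exact (hb.hasFDerivAt q).hasMFDerivAt

theorem velocityEquiv_tangentMapProd_of_isBoundedBilinearMap {b : U × V → W}
    (hb : IsBoundedBilinearMap ℝ b) (X : TangentBundle 𝓘(ℝ, U) U) (Y : TangentBundle 𝓘(ℝ, V) V) :
    velocityEquiv (tangentMapProd 𝓘(ℝ, U) 𝓘(ℝ, V) 𝓘(ℝ, W) b (X, Y)) =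
      (b (X.1, Y.1), b (X.1, (velocityEquiv Y).2) + b ((velocityEquiv X).2, Y.1)) :=
  Prod.ext rfl <|
    DFunLike.congr_fun (hasMFDerivAt_of_isBoundedBilinearMap hb (X.1, Y.1)).mfderiv (X.2, Y.2)

variable [CompleteSpace V]

theorem velocityEquiv_tangentMapProd_units_apply (F : TangentBundle 𝓘(ℝ, V →L[ℝ] V) (V →L[ℝ] V)ˣ)
    (Y : TangentBundle 𝓘(ℝ, V) V) :
    velocityEquiv (tangentMapProd 𝓘(ℝ, V →L[ℝ] V) 𝓘(ℝ, V) 𝓘(ℝ, V)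
      (fun q : (V →L[ℝ] V)ˣ × V => (q.1 : V →L[ℝ] V) q.2) (F, Y)) =
      ((F.1 : V →L[ℝ] V) Y.1,
        (F.1 : V →L[ℝ] V) (velocityEquiv Y).2 + unitsVelocity F Y.1) := by
  have happly : IsBoundedBilinearMap ℝ fun q : (V →L[ℝ] V) × V => q.1 q.2 :=
    isBoundedBilinearMap_apply
  have happly_diff : MDifferentiable (𝓘(ℝ, V →L[ℝ] V).prod 𝓘(ℝ, V)) 𝓘(ℝ, V)
      fun q : (V →L[ℝ] V) × V => q.1 q.2 :=
    fun q => (hasMFDerivAt_of_isBoundedBilinearMap happly q).mdifferentiableAt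
  rw [← tangentMapProd_tangentMap_left happly_diff mdifferentiable_unitsVal]
  exact velocityEquiv_tangentMapProd_of_isBoundedBilinearMap happly _ Y

end VectorSpace

section Units

variable {R S : Type*} [NormedRing R] [NormedAlgebra ℝ R] [CompleteSpace R]
  [NormedRing S] [NormedAlgebra ℝ S] [CompleteSpace S]

theorem unitsVelocity_tangentMap_of_val_eq {L : R →L[ℝ] S} {f : Rˣ → Sˣ}
    (hfL : ∀ a, (f a : S) = L a) (Y : TangentBundle 𝓘(ℝ, R) Rˣ) :
    unitsVelocity (tangentMap 𝓘(ℝ, R) 𝓘(ℝ, S) f Y) = L (unitsVelocity Y) := by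
  have val_comp : (fun a => (f a : S)) = L ∘ fun a : Rˣ => (a : R) := funext hfL
  have hf : ContMDiff 𝓘(ℝ, R) 𝓘(ℝ, S) 1 f :=
    ContMDiff.of_comp_isOpenEmbedding Units.isOpenEmbedding_val <|
      (L.contDiff.contMDiff.comp Units.contMDiff_val).congr hfL
  rw [unitsVelocity_tangentMap (hf.mdifferentiable one_ne_zero), val_comp,
    mfderiv_comp Y.1 L.mdifferentiableAt (mdifferentiable_unitsVal Y.1),
    L.mfderiv_eq]
  rfl

end Units

section Trivialization

variable {V : Type*} [NormedAddCommGroup V] [NormedSpace ℝ V] [FiniteDimensional ℝ V] {n : ℕ}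

theorem trivialization_apply (α : Module.Basis (Fin n) ℝ V) (Y : TangentBundle 𝓘(ℝ, V) V) :
    trivialization α Y = (Y.1, α.equivFun (velocityEquiv Y).2) := by
  rw [← LinearEquiv.eq_symm_apply]
  exact velocityEquiv.injective (Prod.ext rfl (α.equivFun.symm_apply_apply _).symm)

theorem tangentBasis_repr (α : Module.Basis (Fin n) ℝ V) (Y : TangentBundle 𝓘(ℝ, V) V) :
    ((tangentBasis α).repr Y : Fin n ⊕ Fin n → ℝ) =
      Sum.elim (α.repr Y.1) (α.repr (velocityEquiv Y).2) := by
  have h : (tangentBasis α).repr Y =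
      (α.prod (Pi.basisFun ℝ (Fin n))).repr (trivialization α Y) := rfl
  rw [h, trivialization_apply]
  ext (i | i) <;> simp

end Trivialization

section GeneralLinear

attribute [local instance] Matrix.linftyOpNormedRing Matrix.linftyOpNormedAlgebra
attribute [-instance] instTopologicalSpaceMatrix Matrix.instUniformSpace

variable {n : ℕ}

theorem val_blockHom
    (Y : TangentBundle 𝓘(ℝ, Matrix (Fin n) (Fin n) ℝ) (Matrix (Fin n) (Fin n) ℝ)ˣ) :
    (blockHom Y).val = Matrix.fromBlocks Y.1.val 0 (unitsVelocity Y) Y.1.val := by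
  change Matrix.fromBlocks _ _ (unitsVelocity (rightTranslate Y) * Y.1.val) _ = _
  rw [unitsVelocity_rightTranslate, Units.inv_mul_cancel_right]

variable {V : Type*} [NormedAddCommGroup V] [NormedSpace ℝ V] [FiniteDimensional ℝ V]

theorem unitsVelocity_tangentHom_autToGL (α : Module.Basis (Fin n) ℝ V)
    (F : TangentBundle 𝓘(ℝ, V →L[ℝ] V) (V →L[ℝ] V)ˣ) :
    unitsVelocity (tangentHom (autToGL α) F) = endToMatrix α (unitsVelocity F) :=
  unitsVelocity_tangentMap_of_val_eq (L := LinearMap.toContinuousLinearMap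
    ((LinearMap.toMatrix α α).toLinearMap ∘ₗ LinearMap.toContinuousLinearMap.symm.toLinearMap))
    (fun _ => rfl) F

theorem val_blockHom_tangentHom_autToGL (α : Module.Basis (Fin n) ℝ V)
    (F : TangentBundle 𝓘(ℝ, V →L[ℝ] V) (V →L[ℝ] V)ˣ) :
    (blockHom (tangentHom (autToGL α) F)).val =
      Matrix.fromBlocks (endToMatrix α F.1) 0 (endToMatrix α (unitsVelocity F))
        (endToMatrix α F.1) := by
  rw [val_blockHom, unitsVelocity_tangentHom_autToGL]
  rfl

theorem endToMatrix_mulVec_repr (α : Module.Basis (Fin n) ℝ V) (F : V →L[ℝ] V) (p : V) :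
    (endToMatrix α F).mulVec (α.repr p) = α.repr (F p) :=
  LinearMap.toMatrix_mulVec_repr α α (F : V →ₗ[ℝ] V) p

theorem repr_autTangentToGL_symm_apply (α : Module.Basis (Fin n) ℝ V)
    (A : (Matrix (Fin n ⊕ Fin n) (Fin n ⊕ Fin n) ℝ)ˣ) (Y : TangentBundle 𝓘(ℝ, V) V) :
    ((tangentBasis α).repr ((autTangentToGL α).symm A Y) : Fin n ⊕ Fin n → ℝ) =
      A.val.mulVec ((tangentBasis α).repr Y) :=
  Matrix.repr_toLin (tangentBasis α) (tangentBasis α) A.val Y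

theorem velocityEquiv_autTangentToGL_symm_blockHom (α : Module.Basis (Fin n) ℝ V)
    (F : TangentBundle 𝓘(ℝ, V →L[ℝ] V) (V →L[ℝ] V)ˣ) (Y : TangentBundle 𝓘(ℝ, V) V) :
    velocityEquiv ((autTangentToGL α).symm (blockHom (tangentHom (autToGL α) F)) Y) =
      ((F.1 : V →L[ℝ] V) Y.1,
        (F.1 : V →L[ℝ] V) (velocityEquiv Y).2 + unitsVelocity F Y.1) := by
  have coordinates := repr_autTangentToGL_symm_apply α (blockHom (tangentHom (autToGL α) F)) Y
  rw [val_blockHom_tangentHom_autToGL, tangentBasis_repr, tangentBasis_repr,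
    Matrix.fromBlocks_mulVec, Sum.elim_comp_inl, Sum.elim_comp_inr, Matrix.zero_mulVec, add_zero,
    endToMatrix_mulVec_repr, endToMatrix_mulVec_repr, endToMatrix_mulVec_repr, add_comm,
    ← Finsupp.coe_add, ← map_add] at coordinates
  obtain ⟨base, velocity⟩ := Sum.elim_eq_iff.mp coordinates
  exact Prod.ext (α.repr.injective (DFunLike.coe_injective base))
    (α.repr.injective (DFunLike.coe_injective velocity))

theorem tangentMapProd_units_apply_eq_autTangentToGL_symm (α : Module.Basis (Fin n) ℝ V)
    (F : TangentBundle 𝓘(ℝ, V →L[ℝ] V) (V →L[ℝ] V)ˣ) (Y : TangentBundle 𝓘(ℝ, V) V) :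
    tangentMapProd 𝓘(ℝ, V →L[ℝ] V) 𝓘(ℝ, V) 𝓘(ℝ, V)
      (fun q : (V →L[ℝ] V)ˣ × V => (q.1 : V →L[ℝ] V) q.2) (F, Y) =
      (autTangentToGL α).symm (blockHom (tangentHom (autToGL α) F)) Y := by
  have : CompleteSpace V := FiniteDimensional.complete ℝ V
  apply velocityEquiv.injective
  rw [velocityEquiv_tangentMapProd_units_apply, velocityEquiv_autTangentToGL_symm_blockHom]

end GeneralLinear

section Representation

variable {E H G : Type*} [NormedAddCommGroup E] [NormedSpace ℝ E] [TopologicalSpace H]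
  {I : ModelWithCorners ℝ E H} [TopologicalSpace G] [ChartedSpace H G] [Group G]
  {V : Type*} [NormedAddCommGroup V] [NormedSpace ℝ V]

theorem contMDiff_units_apply [CompleteSpace V] {m : WithTop ℕ∞} :
    ContMDiff (𝓘(ℝ, V →L[ℝ] V).prod 𝓘(ℝ, V)) 𝓘(ℝ, V) m
      (fun q : (V →L[ℝ] V)ˣ × V => (q.1 : V →L[ℝ] V) q.2) :=
  (Units.contMDiff_val.comp contMDiff_fst).clm_apply contMDiff_snd

theorem tangentMapProd_representation_eq_prolongation [LieGroup I ∞ G] [FiniteDimensional ℝ V]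
    {n : ℕ} (α : Module.Basis (Fin n) ℝ V)
    (Φ : ContMDiffMonoidMorphism I 𝓘(ℝ, V →L[ℝ] V) ∞ G (V →L[ℝ] V)ˣ)
    (X : TangentBundle I G) (Y : TangentBundle 𝓘(ℝ, V) V) :
    tangentMapProd I 𝓘(ℝ, V) 𝓘(ℝ, V)
      (fun q : G × V => (Φ.toMonoidHom q.1 : V →L[ℝ] V) q.2) (X, Y) = prolongation α Φ X Y := by
  have : CompleteSpace V := FiniteDimensional.complete ℝ V
  have hΦ : MDifferentiable I 𝓘(ℝ, V →L[ℝ] V) Φ.toMonoidHom :=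
    Φ.contMDiff_toFun.mdifferentiable (by simp)
  rw [← tangentMapProd_tangentMap_left (contMDiff_units_apply.mdifferentiable one_ne_zero) hΦ]
  exact tangentMapProd_units_apply_eq_autTangentToGL_symm α (tangentHom Φ X) Y

end Representation

end Prolongation

theorem proposition3p7_general
    {E : Type*} [NormedAddCommGroup E] [NormedSpace ℝ E]
    {H : Type*} [TopologicalSpace H] {I : ModelWithCorners ℝ E H}
    {G : Type*} [TopologicalSpace G] [ChartedSpace H G] [Group G] [LieGroup I ∞ G]
    {V : Type*} [NormedAddCommGroup V] [NormedSpace ℝ V] [FiniteDimensional ℝ V]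
    {n : ℕ} (α : Module.Basis (Fin n) ℝ V)
    (Φ : ContMDiffMonoidMorphism I 𝓘(ℝ, V →L[ℝ] V) ∞ G (V →L[ℝ] V)ˣ)
    (ρ : G × V → V) (hρ : ∀ (a : G) (p : V), ρ (a, p) = (Φ.toMonoidHom a : V →L[ℝ] V) p)
    (Tρ : TangentBundle I G × TangentBundle 𝓘(ℝ, V) V → TangentBundle 𝓘(ℝ, V) V)
    (hTρ : Tρ = Prolongation.tangentMapProd I 𝓘(ℝ, V) 𝓘(ℝ, V) ρ) :
    (ContMDiff (I.tangent.prod 𝓘(ℝ, V).tangent) 𝓘(ℝ, V).tangent ∞ Tρ ∧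
      (∀ Y : TangentBundle 𝓘(ℝ, V) V, Tρ (1, Y) = Y) ∧
      ∀ (X X' : TangentBundle I G) (Y : TangentBundle 𝓘(ℝ, V) V),
        Tρ (X * X', Y) = Tρ (X, Tρ (X', Y))) ∧
    ∀ (X : TangentBundle I G) (Y : TangentBundle 𝓘(ℝ, V) V),
      Tρ (X, Y) = Prolongation.prolongation α Φ X Y := by
  have : CompleteSpace V := FiniteDimensional.complete ℝ V
  obtain rfl : ρ = fun q => (Φ.toMonoidHom q.1 : V →L[ℝ] V) q.2 := funext fun q => hρ q.1 q.2
  subst hTρ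
  have smooth : ContMDiff (I.prod 𝓘(ℝ, V)) 𝓘(ℝ, V) ∞
      (fun q : G × V => (Φ.toMonoidHom q.1 : V →L[ℝ] V) q.2) :=
    Prolongation.contMDiff_units_apply.comp
      ((Φ.contMDiff_toFun.comp contMDiff_fst).prodMk contMDiff_snd)
  have differentiable := smooth.mdifferentiable (by simp)
  exact ⟨⟨Prolongation.contMDiff_tangentMapProd smooth (by simp),
    Prolongation.tangentMapProd_one_left differentiable (by simp),
    Prolongation.tangentMapProd_mul_left differentiable (by simp)⟩,
    Prolongation.tangentMapProd_representation_eq_prolongation α Φ⟩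

theorem proposition3p7
    {E : Type*} [NormedAddCommGroup E] [NormedSpace ℝ E] [FiniteDimensional ℝ E]
    {H : Type*} [TopologicalSpace H] {I : ModelWithCorners ℝ E H} [I.Boundaryless]
    {G : Type*} [TopologicalSpace G] [ChartedSpace H G] [Group G] [LieGroup I ∞ G]
    {V : Type*} [NormedAddCommGroup V] [NormedSpace ℝ V] [FiniteDimensional ℝ V]
    {n : ℕ} (α : Module.Basis (Fin n) ℝ V)
    (Φ : ContMDiffMonoidMorphism I 𝓘(ℝ, V →L[ℝ] V) ∞ G (V →L[ℝ] V)ˣ)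
    (ρ : G × V → V) (hρ : ∀ (a : G) (p : V), ρ (a, p) = (Φ.toMonoidHom a : V →L[ℝ] V) p)
    (Tρ : TangentBundle I G × TangentBundle 𝓘(ℝ, V) V → TangentBundle 𝓘(ℝ, V) V)
    (hTρ : Tρ = Prolongation.tangentMapProd I 𝓘(ℝ, V) 𝓘(ℝ, V) ρ) :
    (ContMDiff (I.tangent.prod 𝓘(ℝ, V).tangent) 𝓘(ℝ, V).tangent ∞ Tρ ∧
      (∀ Y : TangentBundle 𝓘(ℝ, V) V, Tρ (1, Y) = Y) ∧
      ∀ (X X' : TangentBundle I G) (Y : TangentBundle 𝓘(ℝ, V) V),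
        Tρ (X * X', Y) = Tρ (X, Tρ (X', Y))) ∧
    ∀ (X : TangentBundle I G) (Y : TangentBundle 𝓘(ℝ, V) V),
      Tρ (X, Y) = Prolongation.prolongation α Φ X Y :=
  proposition3p7_general α Φ ρ hρ Tρ hTρ
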